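/- Let $\mathcal F$ be the class of random variables $X$ with absolutely continuous law for which there are $-\infty\le\alpha<\omega\le+\infty$ such that $\Pr(\alpha<X<\omega)=1$ and the distribution function $F$ of $X$ is differentiable on $(\alpha,\omega)$ with a density $f=F'$ that is strictly positive and continuous on $(\alpha,\omega)$. For an integrable random variable $X$ let $\mu_k(X)=\mathbb E\max\{X_1,\dots,X_k\}$, where $X_1,\dots,X_k$ are independent copies of $X$. We say that $g:[1,\infty)\to\mathbb R$ has the integral form $(h,s)$ if $h,s:(0,\infty)\to\mathbb R$ are measurable, $h\ge 0$, $$0<\int_0^\infty h(y)e^{-y}(1-e^{-y})\,dy<\infty,\qquad\text{and}\qquad g(x)=\int_0^\infty h(y)\bigl(s(y)-e^{-xy}\bigr)\,dy\quad\text{for all }x\ge 1,$$ where the last integrand is required to be Lebesgue integrable for every $x\ge1$. **Theorem.** For a real sequence $(\mu_k)_{k\ge1}$ the following are equivalent: (i) there is an integrable random variable $X\in\mathcal F$ with $\mu_k(X)=\mu_k$ for all $k\ge 1$; (ii) there is a function $g:[1,\infty)\to\mathbb R$ with $g(k)=\mu_k$ for all integers $k\ge1$ that has an integral form $(h_1,s)$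 in which $h_1$ is strictly positive and continuous on $(0,\infty)$. Moreover, suppose that (i) or (ii) holds. Then the law of the integrable $X\in\mathcal F$ in (i) is unique, and the function $g$ in (ii) is unique, even among all functions on $[1,\infty)$ that extend $(\mu_k)$ and have some integral form. If $f$ is the density and $F^{-1}(u)=\inf\{x:F(x)\ge u\}$ the inverse distribution function of $X$, then the function $$h_1(y)=\frac{e^{-y}}{f\bigl(F^{-1}(e^{-y})\bigr)},\qquad 0<y<\infty,$$ is strictly positive and continuous, $g$ has the integral form $(h_1,s)$ for some $s$, and whenever $g$ has an integral form $(h_2,s_2)$, then $h_2=h_1$ almost everywhere on $(0,\infty)$, and $h_2=h_1$ everywhere on $(0,\infty)$ if $h_2$ is continuous. -/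

import Mathlib

open MeasureTheory Set

namespace ExpectedMaxima

/-- The expected maximum `E max(X₁, …, X_k)` of `k` independent copies of a random variable with
law `P`, computed on the product space `(ℝ^k, P ⊗ ⋯ ⊗ P)`. It is used for `k ≥ 1` only. -/
noncomputable def expectedMax (P : Measure ℝ) (k : ℕ) : ℝ :=
  ∫ x : Fin k → ℝ, (⨆ i, x i) ∂(Measure.pi fun _ : Fin k => P)

/-- The open interval `(α, ω)` of real numbers with extended real endpoints. -/
def realIoo (α ω : EReal) : Set ℝ := {x : ℝ | α < (x : EReal) ∧ (x : EReal) < ω}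

/-- The density `f = F'` of a law, as derivative of its distribution function `F`. -/
noncomputable def density (P : Measure ℝ) (x : ℝ) : ℝ :=
  deriv (fun t : ℝ => ProbabilityTheory.cdf P t) x

/-- The inverse distribution function `F⁻¹(u) = inf {x | u ≤ F x}`, used for `0 < u < 1`. -/
noncomputable def quantile (P : Measure ℝ) (u : ℝ) : ℝ :=
  sInf {x : ℝ | u ≤ ProbabilityTheory.cdf P x}

/-- The class `𝓕` (a property of the law of the random variable): absolutely continuous laws
carried by an open interval `(α, ω)`, `-∞ ≤ α < ω ≤ ∞`, on which the distribution function is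
differentiable with strictly positive and continuous derivative. -/
def MemClassF (P : Measure ℝ) : Prop :=
  P ≪ volume ∧
  ∃ α ω : EReal, α < ω ∧ P (realIoo α ω)ᶜ = 0 ∧
    (∀ x ∈ realIoo α ω, DifferentiableAt ℝ (fun t : ℝ => ProbabilityTheory.cdf P t) x) ∧
    (∀ x ∈ realIoo α ω, 0 < density P x) ∧
    ContinuousOn (density P) (realIoo α ω)

/-- `P` is the law of an integrable random variable in `𝓕` whose expected maxima are
`μ 1, μ 2, …` (the value `μ 0` plays no role). -/
def IsClassFLawOf (μ : ℕ → ℝ) (P : Measure ℝ) : Prop :=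
  IsProbabilityMeasure P ∧ Integrable (fun x : ℝ => x) P ∧ MemClassF P ∧
    ∀ k : ℕ, 1 ≤ k → μ k = expectedMax P k

/-- `g(x) = ∫₀^∞ h(y) (s(y) - e^{-xy}) dy` for `x ≥ 1`, with measurable `h, s : (0, ∞) → ℝ`,
`h ≥ 0` and `0 < ∫₀^∞ h(y) e^{-y} (1 - e^{-y}) dy < ∞`. Only the values of `h, s` on `(0, ∞)` and
of `g` on `[1, ∞)` matter. -/
structure IsIntegralForm (g h s : ℝ → ℝ) : Prop where
  measurable_h : Measurable (fun y : Ioi (0 : ℝ) => h y)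
  measurable_s : Measurable (fun y : Ioi (0 : ℝ) => s y)
  nonneg : ∀ y ∈ Ioi (0 : ℝ), 0 ≤ h y
  finite : IntegrableOn (fun y => h y * Real.exp (-y) * (1 - Real.exp (-y))) (Ioi 0)
  pos : 0 < ∫ y in Ioi (0 : ℝ), h y * Real.exp (-y) * (1 - Real.exp (-y))
  integrable : ∀ x : ℝ, 1 ≤ x →
    IntegrableOn (fun y => h y * (s y - Real.exp (-(x * y)))) (Ioi 0)
  eq : ∀ x : ℝ, 1 ≤ x → g x = ∫ y in Ioi (0 : ℝ), h y * (s y - Real.exp (-(x * y)))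

/-- `g` on `[1, ∞)` extends the sequence `μ 1, μ 2, …`. -/
def Extends (μ : ℕ → ℝ) (g : ℝ → ℝ) : Prop := ∀ k : ℕ, 1 ≤ k → μ k = g k

/-- `g` extends `μ` and has an integral form with a strictly positive continuous `h`. -/
def IsRegularExtension (μ : ℕ → ℝ) (g : ℝ → ℝ) : Prop :=
  Extends μ g ∧ ∃ h s : ℝ → ℝ, IsIntegralForm g h s ∧
    (∀ y ∈ Ioi (0 : ℝ), 0 < h y) ∧ ContinuousOn h (Ioi 0)

/-- The function `y ↦ e^{-y} / f(F⁻¹(e^{-y}))`. -/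
noncomputable def hOfLaw (P : Measure ℝ) (y : ℝ) : ℝ :=
  Real.exp (-y) / density P (quantile P (Real.exp (-y)))

end ExpectedMaxima

/-!
Write `F` for the distribution function of a law `P` in the class, `Q = F⁻¹` for its quantile
function and `h(y) = e^{-y} / f(Q(e^{-y}))`, so that `d/dy Q(e^{-y}) = -h(y)`. Two facts carry the
proof.

*Expected maxima are integrals of `h`.* Applying Tonelli's theorem to the length of `[X₁, max Xᵢ)`
gives `E max(X₁, …, X_k) - E X = ∫ (F - F^k) dt` (`lintegral_max_sub`, `expectedMax_eq`). The
substitution `t = Q(e^{-y})` (`IsRegularOn.lintegral_comp_cdf`) turns this into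
`∫₀^∞ h(y) (e^{-y} - e^{-ky}) dy`, which makes sense for real `k ≥ 1`, and a suitable choice of `s`
absorbs the mean (`isIntegralForm_of_continuousOn`). Conversely, a continuous `h > 0` determines
`Q(u) = c - ∫_1^{-log u} h`, and the image of the uniform law on `(0, 1)` under `Q` is in the class
with explicit function `h` (`hOfLaw_quantileOfForm`). The finiteness condition on `h` says that
`∫ F (1 - F) dt < ∞`, which forces integrability (`integrable_of_lintegral_cdf`), and `c` adjusts
the mean (`exists_law_of_form`).

*The sequence determines `h`.* In any integral form the successive differences of the `μ k` are
the moments `∫₀^∞ e^{-ny} h(y) e^{-y} (1 - e^{-y}) dy`, `n ≥ 0`. By Weierstrass's theorem in the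
variable `u = e^{-y}` these determine `h` almost everywhere (`ae_eq_zero_of_exp_moments`,
`IsIntegralForm.ae_eq`). Hence `g`, whose increments from `x = 1` are integrals of `h`, is unique,
and so is the law: `h` determines `Q` up to an additive constant, which the mean `μ 1` fixes
(`IsClassFLawOf.unique`).
-/

namespace ExpectedMaxima

/-! ### Functions on the half-line determined by their exponential moments -/

/-- Under `y = -log u`, a function that vanishes near `0` and near `∞` becomes continuous on all
of `ℝ`. -/
theorem continuous_comp_neg_log {ρ : ℝ → ℝ} (hρ : Continuous ρ) (hc : HasCompactSupport ρ)
    (h0 : ρ 0 = 0) : Continuous fun u => ρ (-Real.log u) := by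
  refine continuous_iff_continuousAt.2 fun u => ?_
  by_cases hu : u = 0
  -- `-log u → ∞` as `u → 0`, where `ρ` vanishes; at `u = 0` itself `log 0 = 0` and `ρ 0 = 0`.
  · subst hu
    have h1 : ∀ᶠ u in nhdsWithin (0 : ℝ) {0}ᶜ, ρ (-Real.log u) = 0 := by
      have h2 : Filter.Tendsto (fun u => -Real.log u) (nhdsWithin (0 : ℝ) {0}ᶜ) Filter.atTop :=
        Filter.tendsto_neg_atBot_atTop.comp Real.tendsto_log_nhdsNE_zero
      have h3 : ∀ᶠ y in Filter.atTop, ρ y = 0 := by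
        have h4 := hasCompactSupport_iff_eventuallyEq.1 hc
        rw [Filter.coclosedCompact_eq_cocompact] at h4
        exact h4.filter_mono atTop_le_cocompact
      exact h2.eventually h3
    have h5 : (fun u => ρ (-Real.log u)) =ᶠ[nhds 0] fun _ => (0 : ℝ) := by
      rw [eventually_nhdsWithin_iff] at h1
      filter_upwards [h1] with v hv
      by_cases hv0 : v = 0
      · simp [hv0, h0]
      · exact hv hv0
    exact continuousAt_const.congr h5.symm
  · exact hρ.continuousAt.comp (Real.continuousAt_log hu).neg

theorem integrableOn_mul_exp {φ : ℝ → ℝ} (hφ : IntegrableOn φ (Ioi 0)) (n : ℕ) :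
    IntegrableOn (fun y => φ y * Real.exp (-y) ^ n) (Ioi 0) := by
  refine Integrable.mul_bdd (c := 1) hφ (by fun_prop) ?_
  filter_upwards [ae_restrict_mem measurableSet_Ioi] with y hy
  have hy : (0 : ℝ) < y := hy
  rw [Real.norm_of_nonneg (by positivity)]
  exact pow_le_one₀ (Real.exp_pos _).le (Real.exp_le_one_iff.2 (by linarith))

/-- An integrable function on `(0, ∞)` all of whose moments against `e^{-y}` vanish is zero almost
everywhere: by Weierstrass, polynomials in `e^{-y}` approximate every test function uniformly. -/
theorem ae_eq_zero_of_exp_moments {φ : ℝ → ℝ} (hφ : IntegrableOn φ (Ioi 0))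
    (hm : ∀ n : ℕ, ∫ y in Ioi (0 : ℝ), φ y * Real.exp (-y) ^ n = 0) :
    φ =ᵐ[volume.restrict (Ioi 0)] 0 := by
  have hp : ∀ p : Polynomial ℝ, IntegrableOn (fun y => φ y * p.eval (Real.exp (-y))) (Ioi 0) ∧
      ∫ y in Ioi (0 : ℝ), φ y * p.eval (Real.exp (-y)) = 0 := by
    intro p
    have hi : ∀ i ∈ p.support, Integrable (fun y => φ y * (p.coeff i * Real.exp (-y) ^ i))
        (volume.restrict (Ioi 0)) := fun i _ => by
      have := (integrableOn_mul_exp hφ i).const_mul (p.coeff i)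
      refine this.congr (Filter.Eventually.of_forall fun y => ?_)
      simp only
      ring
    simp only [Polynomial.eval_eq_sum, Polynomial.sum, Finset.mul_sum]
    refine ⟨integrable_finsetSum _ hi, ?_⟩
    rw [integral_finsetSum _ hi]
    refine Finset.sum_eq_zero fun i _ => ?_
    have : ∀ y, φ y * (p.coeff i * Real.exp (-y) ^ i) = p.coeff i * (φ y * Real.exp (-y) ^ i) :=
      fun y => by ring
    simp only [this, integral_const_mul, hm i, mul_zero]
  have key := isOpen_Ioi.ae_eq_zero_of_integral_contDiff_smul_eq_zero (μ := volume)
    hφ.locallyIntegrableOn (fun ρ hρ hc hs => by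
      have h0 : ∀ y ∉ Ioi (0 : ℝ), ρ y = 0 := fun y hy => by
        by_contra h
        exact hy (hs (subset_tsupport _ h))
      have hsupp : ∫ y, ρ y • φ y = ∫ y in Ioi (0 : ℝ), φ y * ρ y := by
        rw [← setIntegral_eq_integral_of_forall_compl_eq_zero (s := Ioi (0 : ℝ))]
        · simp only [smul_eq_mul, mul_comm]
        · intro y hy
          simp [h0 y hy]
      rw [hsupp]
      have hG := continuous_comp_neg_log hρ.continuous hc (h0 0 (by simp))
      have hρi : IntegrableOn (fun y => φ y * ρ y) (Ioi 0) := by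
        obtain ⟨C, hC⟩ := hρ.continuous.bounded_above_of_compact_support hc
        exact Integrable.mul_bdd (c := C) hφ hρ.continuous.aestronglyMeasurable
          (Filter.Eventually.of_forall hC)
      refine abs_eq_zero.1 (le_antisymm (le_of_forall_pos_le_add fun ε hε => ?_) (abs_nonneg _))
      set M := ∫ y in Ioi (0 : ℝ), |φ y|
      have hM : 0 ≤ M := integral_nonneg fun _ => abs_nonneg _
      obtain ⟨p, hpε⟩ := exists_polynomial_near_of_continuousOn 0 1 _ hG.continuousOn
        (ε / (M + 1)) (by positivity)
      have e1 : ∫ y in Ioi (0 : ℝ), φ y * ρ y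
          = ∫ y in Ioi (0 : ℝ), (φ y * ρ y - φ y * p.eval (Real.exp (-y))) := by
        rw [integral_sub hρi (hp p).1, (hp p).2, sub_zero]
      rw [e1, zero_add, ← Real.norm_eq_abs]
      calc ‖∫ y in Ioi (0 : ℝ), (φ y * ρ y - φ y * p.eval (Real.exp (-y)))‖
          ≤ ∫ y in Ioi (0 : ℝ), |φ y| * (ε / (M + 1)) := by
            refine norm_integral_le_of_norm_le (hφ.abs.mul_const _) ?_
            filter_upwards [ae_restrict_mem measurableSet_Ioi] with y hy
            have hy : (0 : ℝ) < y := hy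
            have h2 := hpε (Real.exp (-y))
              ⟨(Real.exp_pos _).le, Real.exp_le_one_iff.2 (by linarith)⟩
            rw [Real.log_exp, neg_neg, abs_sub_comm] at h2
            rw [← mul_sub, norm_mul, Real.norm_eq_abs, Real.norm_eq_abs]
            gcongr
        _ = M * (ε / (M + 1)) := integral_mul_const _ _
        _ ≤ ε := by
            rw [mul_div_assoc', div_le_iff₀ (by positivity)]
            nlinarith)
  exact (ae_restrict_iff' measurableSet_Ioi).2 key

/-! ### Integral forms -/

/-- Bernoulli's inequality bounds the kernel of `g x - g 1` by that of the finiteness condition. -/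
theorem exp_sub_exp_le {x y : ℝ} (hx : 1 ≤ x) (hy : 0 < y) :
    0 ≤ Real.exp (-y) - Real.exp (-(x * y)) ∧
      Real.exp (-y) - Real.exp (-(x * y))
        ≤ (⌈x⌉₊ : ℝ) * (Real.exp (-y) * (1 - Real.exp (-y))) := by
  have hv0 := Real.exp_pos (-y)
  have hv1 : Real.exp (-y) ≤ 1 := Real.exp_le_one_iff.2 (by linarith)
  constructor
  · have : Real.exp (-(x * y)) ≤ Real.exp (-y) := Real.exp_le_exp.2 (by nlinarith)
    linarith
  · have h1 : Real.exp (-y) * Real.exp (-y) ^ ⌈x⌉₊ ≤ Real.exp (-(x * y)) := by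
      rw [← Real.exp_nat_mul, ← Real.exp_add]
      refine Real.exp_le_exp.2 ?_
      have := Nat.le_ceil x
      nlinarith
    have h2 := one_add_mul_le_pow (a := Real.exp (-y) - 1) (by linarith) ⌈x⌉₊
    have h3 : 1 + (Real.exp (-y) - 1) = Real.exp (-y) := by ring
    rw [h3] at h2
    nlinarith

theorem integrableOn_mul_exp_sub_exp {h : ℝ → ℝ}
    (hm : AEStronglyMeasurable h (volume.restrict (Ioi 0)))
    (hf : IntegrableOn (fun y => h y * Real.exp (-y) * (1 - Real.exp (-y))) (Ioi 0))
    {x : ℝ} (hx : 1 ≤ x) :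
    IntegrableOn (fun y => h y * (Real.exp (-y) - Real.exp (-(x * y)))) (Ioi 0) := by
  refine (hf.norm.const_mul (⌈x⌉₊ : ℝ)).mono' (hm.mul (by fun_prop)) ?_
  filter_upwards [ae_restrict_mem measurableSet_Ioi] with y hy
  obtain ⟨h1, h2⟩ := exp_sub_exp_le hx hy
  have h3 : 0 ≤ Real.exp (-y) * (1 - Real.exp (-y)) := by
    have : Real.exp (-y) ≤ 1 := Real.exp_le_one_iff.2 (by linarith [show (0 : ℝ) < y from hy])
    have := Real.exp_pos (-y)
    nlinarith
  rw [mul_assoc (h y), norm_mul, norm_mul, Real.norm_of_nonneg h1, Real.norm_of_nonneg h3]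
  have := mul_le_mul_of_nonneg_left h2 (norm_nonneg (h y))
  linarith

theorem aestronglyMeasurable_of_subtype {h : ℝ → ℝ}
    (hm : Measurable fun y : Ioi (0 : ℝ) => h y) :
    AEStronglyMeasurable h (volume.restrict (Ioi 0)) :=
  ((aemeasurable_restrict_iff_comap_subtype measurableSet_Ioi).2
    hm.aemeasurable).aestronglyMeasurable

/-- The centring function `s` cancels in differences of values of `g`. -/
theorem IsIntegralForm.eq_add {g h s : ℝ → ℝ} (H : IsIntegralForm g h s) {x : ℝ} (hx : 1 ≤ x) :
    g x = g 1 + ∫ y in Ioi (0 : ℝ), h y * (Real.exp (-y) - Real.exp (-(x * y))) := by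
  have h1 : ∫ y in Ioi (0 : ℝ), h y * (Real.exp (-y) - Real.exp (-(x * y))) = g x - g 1 := by
    rw [H.eq x hx, H.eq 1 le_rfl, ← integral_sub (H.integrable x hx) (H.integrable 1 le_rfl)]
    refine integral_congr_ae (Filter.Eventually.of_forall fun y => ?_)
    simp only [one_mul]
    ring
  linarith

theorem IsIntegralForm.integrableOn_sub {g h s : ℝ → ℝ} (H : IsIntegralForm g h s) {x : ℝ}
    (hx : 1 ≤ x) :
    IntegrableOn (fun y => h y * (Real.exp (-y) - Real.exp (-(x * y)))) (Ioi 0) :=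
  integrableOn_mul_exp_sub_exp (aestronglyMeasurable_of_subtype H.measurable_h) H.finite hx

/-- Successive differences of the values at integers are the exponential moments of
`h(y) e^{-y} (1 - e^{-y})`. -/
theorem IsIntegralForm.moment {g h s : ℝ → ℝ} (H : IsIntegralForm g h s) (n : ℕ) :
    ∫ y in Ioi (0 : ℝ), h y * Real.exp (-y) * (1 - Real.exp (-y)) * Real.exp (-y) ^ n
      = g ((n + 2 : ℕ) : ℝ) - g ((n + 1 : ℕ) : ℝ) := by
  have h2 : (1 : ℝ) ≤ ((n + 2 : ℕ) : ℝ) := by exact_mod_cast Nat.le_add_left 1 (n + 1)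
  have h1 : (1 : ℝ) ≤ ((n + 1 : ℕ) : ℝ) := by exact_mod_cast Nat.le_add_left 1 n
  rw [H.eq_add h2, H.eq_add h1, add_sub_add_left_eq_sub,
    ← integral_sub (H.integrableOn_sub h2) (H.integrableOn_sub h1)]
  refine integral_congr_ae (Filter.Eventually.of_forall fun y => ?_)
  have e : ∀ m : ℕ, Real.exp (-((m : ℝ) * y)) = Real.exp (-y) ^ m := fun m => by
    rw [← Real.exp_nat_mul]
    congr 1
    ring
  simp only [e]
  ring

theorem IsIntegralForm.ae_eq {μ : ℕ → ℝ} {g g' h h' s s' : ℝ → ℝ} (H : IsIntegralForm g h s)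
    (H' : IsIntegralForm g' h' s') (hg : Extends μ g) (hg' : Extends μ g') :
    h =ᵐ[volume.restrict (Ioi 0)] h' := by
  have h0 := ae_eq_zero_of_exp_moments (H.finite.sub H'.finite) (fun n => by
    have e : ∀ y, ((fun y => h y * Real.exp (-y) * (1 - Real.exp (-y))) -
          fun y => h' y * Real.exp (-y) * (1 - Real.exp (-y))) y * Real.exp (-y) ^ n
        = h y * Real.exp (-y) * (1 - Real.exp (-y)) * Real.exp (-y) ^ n
          - h' y * Real.exp (-y) * (1 - Real.exp (-y)) * Real.exp (-y) ^ n := fun y => by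
      simp only [Pi.sub_apply]
      ring
    simp only [e]
    rw [integral_sub (integrableOn_mul_exp H.finite n) (integrableOn_mul_exp H'.finite n),
      H.moment, H'.moment, ← hg _ (by omega), ← hg' _ (by omega), ← hg _ (by omega),
      ← hg' _ (by omega), sub_self])
  filter_upwards [h0, ae_restrict_mem measurableSet_Ioi] with y hy hy0
  have hy0 : (0 : ℝ) < y := hy0
  have h1 : Real.exp (-y) < 1 := Real.exp_lt_one_iff.2 (by linarith)
  simp only [Pi.sub_apply, Pi.zero_apply, ← sub_mul, mul_assoc] at hy
  have h2 : Real.exp (-y) * (1 - Real.exp (-y)) ≠ 0 :=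
    (mul_pos (Real.exp_pos _) (by linarith)).ne'
  exact sub_eq_zero.1 ((mul_eq_zero.1 hy).resolve_right h2)

theorem IsIntegralForm.eqOn {μ : ℕ → ℝ} {g g' h h' s s' : ℝ → ℝ} (H : IsIntegralForm g h s)
    (H' : IsIntegralForm g' h' s') (hg : Extends μ g) (hg' : Extends μ g') :
    EqOn g g' (Ici 1) := by
  intro x hx
  rw [H.eq_add hx, H'.eq_add hx]
  have h1 : g 1 = g' 1 := by
    have a := hg 1 le_rfl
    have b := hg' 1 le_rfl
    rw [Nat.cast_one] at a b
    rw [← a, ← b]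
  rw [h1]
  congr 1
  refine integral_congr_ae ?_
  filter_upwards [H.ae_eq H' hg hg'] with y hy
  rw [hy]

/-- For strictly positive continuous `h` subject to the finiteness condition, every value `m` at
`x = 1` can be realized: divide by `h` in the centring function. -/
theorem isIntegralForm_of_continuousOn {h : ℝ → ℝ} (hpos : ∀ y ∈ Ioi (0 : ℝ), 0 < h y)
    (hc : ContinuousOn h (Ioi 0))
    (hf : IntegrableOn (fun y => h y * Real.exp (-y) * (1 - Real.exp (-y))) (Ioi 0)) (m : ℝ) :
    IsIntegralForm
      (fun x => m + ∫ y in Ioi (0 : ℝ), h y * (Real.exp (-y) - Real.exp (-(x * y)))) h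
      (fun y => Real.exp (-y) + m * Real.exp (-y) / h y) := by
  have hhm : Measurable fun y : Ioi (0 : ℝ) => h y :=
    (continuousOn_iff_continuous_domRestrict.1 hc).measurable
  have key : ∀ x : ℝ, ∀ y ∈ Ioi (0 : ℝ),
      m * Real.exp (-y) + h y * (Real.exp (-y) - Real.exp (-(x * y)))
      = h y * (Real.exp (-y) + m * Real.exp (-y) / h y - Real.exp (-(x * y))) := by
    intro x y hy
    have := (hpos y hy).ne'
    field_simp
    ring
  have hexp : IntegrableOn (fun y : ℝ => m * Real.exp (-y)) (Ioi 0) :=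
    (integrableOn_exp_neg_Ioi 0).const_mul m
  refine ⟨hhm, (by fun_prop : Measurable fun y : Ioi (0 : ℝ) => Real.exp (-(y : ℝ))).add
    ((by fun_prop : Measurable fun y : Ioi (0 : ℝ) => m * Real.exp (-(y : ℝ))).div hhm),
    fun y hy => (hpos y hy).le, hf, ?_, fun x hx => ?_, fun x hx => ?_⟩
  · rw [setIntegral_pos_iff_support_of_nonneg_ae _ hf]
    · refine lt_of_lt_of_le (b := volume (Ioi (0 : ℝ))) (by simp) (measure_mono fun y hy => ?_)
      have : Real.exp (-y) < 1 := Real.exp_lt_one_iff.2 (by linarith [show (0 : ℝ) < y from hy])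
      exact ⟨(mul_pos (mul_pos (hpos y hy) (Real.exp_pos _)) (by linarith)).ne', hy⟩
    · filter_upwards [ae_restrict_mem measurableSet_Ioi] with y hy
      have : Real.exp (-y) < 1 := Real.exp_lt_one_iff.2 (by linarith [show (0 : ℝ) < y from hy])
      exact (mul_pos (mul_pos (hpos y hy) (Real.exp_pos _)) (by linarith)).le
  · exact IntegrableOn.congr_fun (hexp.add (integrableOn_mul_exp_sub_exp
      (aestronglyMeasurable_of_subtype hhm) hf hx)) (key x) measurableSet_Ioi
  · rw [← setIntegral_congr_fun measurableSet_Ioi (key x), integral_add hexp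
      (integrableOn_mul_exp_sub_exp (aestronglyMeasurable_of_subtype hhm) hf hx),
      integral_const_mul, integral_exp_neg_Ioi_zero, mul_one]

/-! ### Expected maxima and distribution functions -/

/-- Tonelli's theorem for the length of the interval `[x₁, max xᵢ)`. -/
theorem lintegral_max_sub (P : Measure ℝ) [IsProbabilityMeasure P] (n : ℕ) :
    ∫⁻ x : Fin (n + 1) → ℝ, ENNReal.ofReal ((⨆ i, x i) - x 0) ∂(Measure.pi fun _ => P)
      = ∫⁻ t : ℝ, ENNReal.ofReal
          (ProbabilityTheory.cdf P t - ProbabilityTheory.cdf P t ^ (n + 1)) := by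
  set S : Set ((Fin (n + 1) → ℝ) × ℝ) := {z | z.1 0 ≤ z.2} ∩ {z | z.2 < ⨆ i, z.1 i} with hS
  have hsup : Measurable fun z : (Fin (n + 1) → ℝ) × ℝ => ⨆ i, z.1 i :=
    Measurable.iSup fun i => (measurable_pi_apply i).comp measurable_fst
  have hms : MeasurableSet S :=
    (measurableSet_le ((measurable_pi_apply 0).comp measurable_fst) measurable_snd).inter
      (measurableSet_lt measurable_snd hsup)
  have e1 : ∀ x : Fin (n + 1) → ℝ, ENNReal.ofReal ((⨆ i, x i) - x 0)
      = ∫⁻ t : ℝ, S.indicator 1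
          (x, t) := by
    intro x
    have : ∀ t : ℝ, S.indicator
        (1 : (Fin (n + 1) → ℝ) × ℝ → ENNReal) (x, t)
        = (Ico (x 0) (⨆ i, x i)).indicator 1 t := fun t => rfl
    simp only [this]
    rw [lintegral_indicator_one measurableSet_Ico, Real.volume_Ico]
  simp only [e1]
  rw [lintegral_lintegral_swap
    (f := fun (x : Fin (n + 1) → ℝ) (t : ℝ) =>
      S.indicator
        (1 : (Fin (n + 1) → ℝ) × ℝ → ENNReal) (x, t))
    ((measurable_one.indicator hms).aemeasurable)]
  refine lintegral_congr fun t => ?_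
  have e2 : ∀ x : Fin (n + 1) → ℝ,
      S.indicator
        (1 : (Fin (n + 1) → ℝ) × ℝ → ENNReal) (x, t)
      = (Function.eval (0 : Fin (n + 1)) ⁻¹' Iic t \ univ.pi fun _ => Iic t).indicator 1 x := by
    intro x
    have : (x, t) ∈ S ↔
        x ∈ (Function.eval (0 : Fin (n + 1)) ⁻¹' Iic t \ univ.pi fun _ => Iic t) := by
      simp only [hS, mem_inter_iff, mem_ofPred_eq, mem_sdiff, mem_preimage, Function.eval,
        mem_Iic, mem_univ_pi]
      rw [← ciSup_le_iff (Finite.bddAbove_range x), not_le]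
    by_cases hx : (x, t) ∈ S
    · rw [indicator_of_mem hx, indicator_of_mem (this.1 hx)]; rfl
    · rw [indicator_of_notMem hx, indicator_of_notMem (mt this.2 hx)]
  have hpi : MeasurableSet (univ.pi fun _ : Fin (n + 1) => Iic t) :=
    MeasurableSet.univ_pi fun _ => measurableSet_Iic
  have hev : MeasurableSet (Function.eval (0 : Fin (n + 1)) ⁻¹' Iic t : Set (Fin (n + 1) → ℝ)) :=
    (measurable_pi_apply 0) measurableSet_Iic
  simp only [e2]
  have hsub : (univ.pi fun _ : Fin (n + 1) => Iic t) ⊆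
      (Function.eval (0 : Fin (n + 1)) ⁻¹' Iic t : Set (Fin (n + 1) → ℝ)) :=
    fun x hx => mem_univ_pi.1 hx 0
  rw [lintegral_indicator_one (hev.diff hpi), measure_sdiff hsub
    hpi.nullMeasurableSet (measure_ne_top _ _), Measure.pi_pi,
    (measurePreserving_eval (fun _ : Fin (n + 1) => P) 0).measure_preimage
      measurableSet_Iic.nullMeasurableSet]
  rw [Finset.prod_const, Finset.card_univ, Fintype.card_fin, ← ProbabilityTheory.ofReal_cdf,
    ← ENNReal.ofReal_pow (ProbabilityTheory.cdf_nonneg P t),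
    ENNReal.ofReal_sub _ (pow_nonneg (ProbabilityTheory.cdf_nonneg P t) _)]

theorem expectedMax_eq (P : Measure ℝ) [IsProbabilityMeasure P]
    (hP : Integrable (fun x : ℝ => x) P) {k : ℕ} (hk : 1 ≤ k) :
    ∫⁻ t : ℝ, ENNReal.ofReal (ProbabilityTheory.cdf P t - ProbabilityTheory.cdf P t ^ k) ≠ ⊤ ∧
    expectedMax P k = ∫ x, x ∂P + (∫⁻ t : ℝ, ENNReal.ofReal
      (ProbabilityTheory.cdf P t - ProbabilityTheory.cdf P t ^ k)).toReal := by
  obtain ⟨n, rfl⟩ : ∃ n, k = n + 1 := ⟨k - 1, by omega⟩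
  have hi : ∀ i : Fin (n + 1), Integrable (fun x : Fin (n + 1) → ℝ => x i)
      (Measure.pi fun _ => P) := fun i =>
    (measurePreserving_eval (fun _ : Fin (n + 1) => P) i).integrable_comp_of_integrable hP
  have hmax : Integrable (fun x : Fin (n + 1) → ℝ => ⨆ i, x i) (Measure.pi fun _ => P) := by
    refine (integrable_finsetSum Finset.univ fun i _ => (hi i).abs).mono'
      (Measurable.iSup fun i => measurable_pi_apply i).aestronglyMeasurable
      (Filter.Eventually.of_forall fun x => ?_)
    obtain ⟨j, hj⟩ := exists_eq_ciSup_of_finite (f := x)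
    rw [← hj, Real.norm_eq_abs]
    exact Finset.single_le_sum (f := fun i => |x i|) (fun _ _ => abs_nonneg _) (Finset.mem_univ j)
  have hnn : ∀ x : Fin (n + 1) → ℝ, 0 ≤ (⨆ i, x i) - x 0 := fun x =>
    sub_nonneg.2 (le_ciSup (Finite.bddAbove_range x) 0)
  have hd := hmax.sub (hi 0)
  have e0 : ∫ x : Fin (n + 1) → ℝ, x 0 ∂(Measure.pi fun _ => P) = ∫ x, x ∂P :=
    integral_comp_eval (μ := fun _ : Fin (n + 1) => P) (f := fun x : ℝ => x)
      hP.aestronglyMeasurable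
  rw [← lintegral_max_sub]
  refine ⟨((hasFiniteIntegral_iff_ofReal (Filter.Eventually.of_forall hnn)).1 hd.2).ne, ?_⟩
  rw [← integral_eq_lintegral_of_nonneg_ae (Filter.Eventually.of_forall hnn)
    hd.aestronglyMeasurable, integral_sub hmax (hi 0), e0]
  unfold expectedMax
  ring

/-- Tonelli's theorem for the length of the interval between `a` and `x`. -/
theorem lintegral_abs_sub (P : Measure ℝ) [IsProbabilityMeasure P] (a : ℝ) :
    ∫⁻ x, ENNReal.ofReal |x - a| ∂P = ∫⁻ t : ℝ, ENNReal.ofReal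
      (if t < a then ProbabilityTheory.cdf P t else 1 - ProbabilityTheory.cdf P t) := by
  set S : Set (ℝ × ℝ) := 
    ({z | z.2 < a} ∩ {z | z.1 ≤ z.2}) ∪ ({z | a ≤ z.2} ∩ {z | z.2 < z.1}) with hS
  have hms : MeasurableSet S :=
    ((measurableSet_lt measurable_snd measurable_const).inter
      (measurableSet_le measurable_fst measurable_snd)).union
    ((measurableSet_le measurable_const measurable_snd).inter
      (measurableSet_lt measurable_snd measurable_fst))
  have e1 : ∀ x : ℝ, ENNReal.ofReal |x - a| = ∫⁻ t : ℝ, S.indicator 1 (x, t) := by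
    intro x
    have h1 : ∀ t : ℝ, S.indicator (1 : ℝ × ℝ → ENNReal) (x, t)
        = (Ico x a ∪ Ico a x).indicator 1 t := fun t => by
      have : (x, t) ∈ S ↔ t ∈ Ico x a ∪ Ico a x := by
        simp only [hS, mem_inter_iff, mem_ofPred_eq, mem_union, mem_Ico]
        tauto
      by_cases hx : (x, t) ∈ S
      · rw [indicator_of_mem hx, indicator_of_mem (this.1 hx)]; rfl
      · rw [indicator_of_notMem hx, indicator_of_notMem (mt this.2 hx)]
    simp only [h1]
    rw [lintegral_indicator_one (measurableSet_Ico.union measurableSet_Ico)]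
    rcases le_total x a with h | h
    · rw [Ico_eq_empty (not_lt.2 h), union_empty, Real.volume_Ico, abs_sub_comm,
        abs_of_nonneg (by linarith)]
    · rw [Ico_eq_empty (not_lt.2 h), empty_union, Real.volume_Ico, abs_of_nonneg (by linarith)]
  simp only [e1]
  rw [lintegral_lintegral_swap
    (f := fun (x t : ℝ) => S.indicator (1 : ℝ × ℝ → ENNReal) (x, t))
    ((measurable_one.indicator hms).aemeasurable)]
  refine lintegral_congr fun t => ?_
  split_ifs with ht
  · have h1 : ∀ x : ℝ, S.indicator (1 : ℝ × ℝ → ENNReal) (x, t) = (Iic t).indicator 1 x :=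
      fun x => by simp [hS, indicator, ht, not_le.2 ht]
    simp only [h1]
    rw [lintegral_indicator_one measurableSet_Iic, ProbabilityTheory.ofReal_cdf]
  · have h1 : ∀ x : ℝ, S.indicator (1 : ℝ × ℝ → ENNReal) (x, t) = (Iic t)ᶜ.indicator 1 x :=
      fun x => by simp [hS, indicator, ht, not_lt.1 ht]
    simp only [h1]
    rw [lintegral_indicator_one measurableSet_Iic.compl, prob_compl_eq_one_sub measurableSet_Iic,
      ENNReal.ofReal_sub _ (ProbabilityTheory.cdf_nonneg P t), ProbabilityTheory.ofReal_cdf,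
      ENNReal.ofReal_one]

/-- A nondegenerate law is integrable as soon as `∫ F (1 - F)` is finite. -/
theorem integrable_of_lintegral_cdf (P : Measure ℝ) [IsProbabilityMeasure P] {a : ℝ}
    (h0 : 0 < ProbabilityTheory.cdf P a) (h1 : ProbabilityTheory.cdf P a < 1)
    (hfin : ∫⁻ t : ℝ, ENNReal.ofReal
      (ProbabilityTheory.cdf P t - ProbabilityTheory.cdf P t ^ 2) ≠ ⊤) :
    Integrable (fun x : ℝ => x) P := by
  set p := ProbabilityTheory.cdf P a
  have hsub : Integrable (fun x : ℝ => x - a) P := by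
    refine ⟨by fun_prop, ?_⟩
    rw [hasFiniteIntegral_iff_norm]
    simp only [Real.norm_eq_abs]
    rw [lintegral_abs_sub]
    refine lt_of_le_of_lt (b := ∫⁻ t : ℝ, ENNReal.ofReal (p⁻¹ + (1 - p)⁻¹) * ENNReal.ofReal
      (ProbabilityTheory.cdf P t - ProbabilityTheory.cdf P t ^ 2)) (lintegral_mono fun t => ?_) ?_
    · have hp0 : 0 < p⁻¹ := inv_pos.2 h0
      have hp1 : 0 < (1 - p)⁻¹ := inv_pos.2 (by linarith)
      rw [← ENNReal.ofReal_mul (by positivity)]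
      refine ENNReal.ofReal_le_ofReal ?_
      have hF0 := ProbabilityTheory.cdf_nonneg P t
      have hF1 := ProbabilityTheory.cdf_le_one P t
      set F := ProbabilityTheory.cdf P t
      have hFF : 0 ≤ F * (1 - F) := mul_nonneg hF0 (by linarith)
      have hsq : F - F ^ 2 = F * (1 - F) := by ring
      rw [hsq, add_mul]
      split_ifs with ht
      · have hle : F ≤ p := ProbabilityTheory.monotone_cdf P ht.le
        have : F ≤ (1 - p)⁻¹ * (F * (1 - F)) := by
          rw [inv_mul_eq_div, le_div_iff₀ (by linarith)]
          nlinarith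
        nlinarith [mul_nonneg hp0.le hFF]
      · have hle : p ≤ F := ProbabilityTheory.monotone_cdf P (not_lt.1 ht)
        have : 1 - F ≤ p⁻¹ * (F * (1 - F)) := by
          rw [inv_mul_eq_div, le_div_iff₀ h0]
          nlinarith
        nlinarith [mul_nonneg hp1.le hFF]
    · rw [lintegral_const_mul' _ _ ENNReal.ofReal_ne_top]
      exact ENNReal.mul_lt_top ENNReal.ofReal_lt_top hfin.lt_top
  exact (hsub.add (integrable_const a)).congr (Filter.Eventually.of_forall fun x => by simp)

/-! ### Distribution functions and quantiles in the class -/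

theorem continuous_cdf (P : Measure ℝ) [IsProbabilityMeasure P] (h0 : ∀ x, P {x} = 0) :
    Continuous fun t => ProbabilityTheory.cdf P t := by
  refine continuous_iff_continuousAt.2 fun x => ?_
  have hm := ProbabilityTheory.monotone_cdf P
  rw [hm.continuousAt_iff_leftLim_eq_rightLim, StieltjesFunction.rightLim_eq]
  refine le_antisymm (hm.leftLim_le le_rfl) ?_
  have h := (ProbabilityTheory.cdf P).measure_singleton x
  rw [ProbabilityTheory.measure_cdf, h0 x, eq_comm, ENNReal.ofReal_eq_zero] at h
  linarith

/-- A strictly increasing function with nonzero derivative and open image: a left inverse is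
differentiable on the image. -/
theorem hasDerivAt_leftInverse {f g : ℝ → ℝ} {s : Set ℝ} (hs : IsOpen s)
    (hmono : StrictMonoOn f s) (himg : IsOpen (f '' s)) (hg : ∀ x ∈ s, g (f x) = x) {x f' : ℝ}
    (hx : x ∈ s) (hf : HasDerivAt f f' x) (hf' : f' ≠ 0) : HasDerivAt g f'⁻¹ (f x) := by
  have hgm : StrictMonoOn g (f '' s) := by
    rintro _ ⟨a, ha, rfl⟩ _ ⟨b, hb, rfl⟩ hab
    rw [hg a ha, hg b hb]
    exact (hmono.lt_iff_lt ha hb).1 hab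
  have hgi : g '' (f '' s) = s := by
    rw [image_image]
    exact (image_congr fun a ha => hg a ha).trans (image_id' s)
  have hmem : f '' s ∈ nhds (f x) := himg.mem_nhds (mem_image_of_mem f hx)
  have hgc : ContinuousAt g (f x) := by
    refine hgm.continuousAt_of_image_mem_nhds hmem ?_
    rw [hgi, hg x hx]
    exact hs.mem_nhds hx
  refine HasDerivAt.of_local_left_inverse (f := f) hgc ?_ hf' ?_
  · rwa [hg x hx]
  · filter_upwards [hmem]
    rintro _ ⟨a, ha, rfl⟩
    rw [hg a ha]

/-- The law `P` is carried by the open set `I`, where its distribution function is a strictly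
increasing continuously differentiable bijection onto `(0, 1)`. -/
structure IsRegularOn (P : Measure ℝ) (I : Set ℝ) : Prop where
  isOpen : IsOpen I
  hasDerivAt : ∀ x ∈ I, HasDerivAt (fun t => ProbabilityTheory.cdf P t) (density P x) x
  density_pos : ∀ x ∈ I, 0 < density P x
  continuousOn_density : ContinuousOn (density P) I
  cdf_lt : ∀ x ∈ I, ∀ t < x, ProbabilityTheory.cdf P t < ProbabilityTheory.cdf P x
  image_cdf : (fun t => ProbabilityTheory.cdf P t) '' I = Ioo 0 1
  cdf_notMem : ∀ x ∉ I, ProbabilityTheory.cdf P x = 0 ∨ ProbabilityTheory.cdf P x = 1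

/-- The set `I` is the interval `(α, ω)`: absolute continuity makes `F` continuous on all of `ℝ`,
so by the intermediate value theorem it attains every value in `(0, 1)`, necessarily inside
`(α, ω)`. -/
theorem MemClassF.exists_isRegularOn {P : Measure ℝ} [IsProbabilityMeasure P]
    (h : MemClassF P) : ∃ I, IsRegularOn P I := by
  obtain ⟨hac, α, ω, -, hI, hd, hp, hc⟩ := h
  have hatom : ∀ x, P {x} = 0 := fun x => hac (measure_singleton x)
  have hopen : IsOpen (realIoo α ω) := isOpen_Ioo.preimage continuous_coe_real_ereal
  have hconv : Convex ℝ (realIoo α ω) := OrdConnected.convex ⟨fun x hx y hy z hz =>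
    ⟨hx.1.trans_le (EReal.coe_le_coe_iff.2 hz.1), (EReal.coe_le_coe_iff.2 hz.2).trans_lt hy.2⟩⟩
  have hmono : StrictMonoOn (fun t => ProbabilityTheory.cdf P t) (realIoo α ω) :=
    strictMonoOn_of_deriv_pos hconv (continuous_cdf P hatom).continuousOn
      fun x hx => hp x (interior_subset hx)
  have hzero : ∀ t : ℝ, (t : EReal) ≤ α → ProbabilityTheory.cdf P t = 0 := fun t ht => by
    rw [ProbabilityTheory.cdf_eq_real, measureReal_def, measure_mono_null (fun s hs hs' => ?_) hI,
      ENNReal.toReal_zero]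
    exact absurd hs'.1 (not_lt.2 ((EReal.coe_le_coe_iff.2 hs).trans ht))
  have hone : ∀ t : ℝ, ω ≤ (t : EReal) → ProbabilityTheory.cdf P t = 1 := fun t ht => by
    have hsub : (Iic t)ᶜ ⊆ (realIoo α ω)ᶜ := fun s hs hs' => by
      have hs : t < s := not_le.1 hs
      exact absurd hs'.2 (not_lt.2 (ht.trans (EReal.coe_le_coe_iff.2 hs.le)))
    have : P (Iic t)ᶜ = 0 := measure_mono_null hsub hI
    rw [ProbabilityTheory.cdf_eq_real, measureReal_def,
      (prob_compl_eq_zero_iff measurableSet_Iic).1 this, ENNReal.toReal_one]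
  have hpos : ∀ x ∈ realIoo α ω, 0 < ProbabilityTheory.cdf P x := fun x hx => by
    obtain ⟨z, hz1, hz2⟩ := EReal.lt_iff_exists_real_btwn.1 hx.1
    exact (ProbabilityTheory.cdf_nonneg P z).trans_lt
      (hmono ⟨hz1, hz2.trans hx.2⟩ hx (EReal.coe_lt_coe_iff.1 hz2))
  have hlt1 : ∀ x ∈ realIoo α ω, ProbabilityTheory.cdf P x < 1 := fun x hx => by
    obtain ⟨z, hz1, hz2⟩ := EReal.lt_iff_exists_real_btwn.1 hx.2
    exact (hmono hx ⟨hx.1.trans hz1, hz2⟩ (EReal.coe_lt_coe_iff.1 hz1)).trans_le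
      (ProbabilityTheory.cdf_le_one P z)
  have hnot : ∀ x ∉ realIoo α ω,
      ProbabilityTheory.cdf P x = 0 ∨ ProbabilityTheory.cdf P x = 1 := fun x hx => by
    by_cases h1 : α < (x : EReal)
    · exact Or.inr (hone x (not_lt.1 fun h2 => hx ⟨h1, h2⟩))
    · exact Or.inl (hzero x (not_lt.1 h1))
  refine ⟨realIoo α ω, hopen, fun x hx => (hd x hx).hasDerivAt, hp, hc, fun x hx t ht => ?_,
    Subset.antisymm ?_ fun u hu => ?_, hnot⟩
  · by_cases h1 : α < (t : EReal)
    · exact hmono ⟨h1, (EReal.coe_lt_coe_iff.2 ht).trans hx.2⟩ hx ht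
    · rw [hzero t (not_lt.1 h1)]
      exact hpos x hx
  · rintro _ ⟨x, hx, rfl⟩
    exact ⟨hpos x hx, hlt1 x hx⟩
  · have hrange : u ∈ range fun t => ProbabilityTheory.cdf P t := by
      refine mem_range_of_exists_le_of_exists_ge (continuous_cdf P hatom) ?_ ?_
      · exact ((ProbabilityTheory.tendsto_cdf_atBot P).eventually_le_const hu.1).exists
      · exact ((ProbabilityTheory.tendsto_cdf_atTop P).eventually_const_le hu.2).exists
    obtain ⟨x, hx⟩ := hrange
    refine ⟨x, ?_, hx⟩
    by_contra hxI
    simp only at hx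
    rcases hnot x hxI with h | h
    · exact hu.1.ne (h.symm.trans hx)
    · exact hu.2.ne (hx.symm.trans h)

theorem exp_neg_mem {y : ℝ} (hy : y ∈ Ioi (0 : ℝ)) : Real.exp (-y) ∈ Ioo (0 : ℝ) 1 :=
  ⟨Real.exp_pos _, Real.exp_lt_one_iff.2 (neg_lt_zero.2 hy)⟩

namespace IsRegularOn

variable {P : Measure ℝ} {I : Set ℝ}

theorem strictMonoOn_cdf (R : IsRegularOn P I) :
    StrictMonoOn (fun t => ProbabilityTheory.cdf P t) I := fun _ _ y hy hxy => R.cdf_lt y hy _ hxy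

theorem quantile_cdf (R : IsRegularOn P I) {x : ℝ} (hx : x ∈ I) :
    quantile P (ProbabilityTheory.cdf P x) = x := by
  have : {t | ProbabilityTheory.cdf P x ≤ ProbabilityTheory.cdf P t} = Ici x := by
    ext t
    refine ⟨fun ht => ?_, fun ht => ProbabilityTheory.monotone_cdf P ht⟩
    by_contra hlt
    exact absurd (R.cdf_lt x hx t (not_le.1 hlt)) (not_lt.2 ht)
  rw [quantile, this, csInf_Ici]

theorem cdf_mem (R : IsRegularOn P I) {x : ℝ} (hx : x ∈ I) :
    ProbabilityTheory.cdf P x ∈ Ioo (0 : ℝ) 1 := by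
  rw [← R.image_cdf]
  exact mem_image_of_mem _ hx

theorem quantile_mem (R : IsRegularOn P I) {u : ℝ} (hu : u ∈ Ioo (0 : ℝ) 1) :
    quantile P u ∈ I ∧ ProbabilityTheory.cdf P (quantile P u) = u := by
  rw [← R.image_cdf] at hu
  obtain ⟨x, hx, rfl⟩ := hu
  simp only [R.quantile_cdf hx]
  exact ⟨hx, trivial⟩

/-- Galois connection between the quantile and the distribution function. -/
theorem quantile_le_iff (R : IsRegularOn P I) {u : ℝ} (hu : u ∈ Ioo (0 : ℝ) 1) (x : ℝ) :
    quantile P u ≤ x ↔ u ≤ ProbabilityTheory.cdf P x := by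
  obtain ⟨hm, he⟩ := R.quantile_mem hu
  refine ⟨fun h => ?_, fun h => ?_⟩
  · rw [← he]
    exact ProbabilityTheory.monotone_cdf P h
  · by_contra hlt
    have := R.cdf_lt _ hm x (not_le.1 hlt)
    linarith

theorem hasDerivAt_quantile (R : IsRegularOn P I) {u : ℝ} (hu : u ∈ Ioo (0 : ℝ) 1) :
    HasDerivAt (quantile P) (density P (quantile P u))⁻¹ u := by
  obtain ⟨hm, he⟩ := R.quantile_mem hu
  have := hasDerivAt_leftInverse R.isOpen R.strictMonoOn_cdf (by rw [R.image_cdf]; exact isOpen_Ioo)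
    (fun x hx => R.quantile_cdf hx) hm (R.hasDerivAt _ hm) (R.density_pos _ hm).ne'
  simpa only [he] using this

theorem strictMonoOn_quantile (R : IsRegularOn P I) :
    StrictMonoOn (quantile P) (Ioo 0 1) := fun u hu v hv huv => by
  rw [← not_le, R.quantile_le_iff hv, (R.quantile_mem hu).2, not_le]
  exact huv

theorem aemeasurable_quantile (R : IsRegularOn P I) :
    AEMeasurable (quantile P) (volume.restrict (Ioo 0 1)) :=
  aemeasurable_restrict_of_monotoneOn measurableSet_Ioo R.strictMonoOn_quantile.monotoneOn

/-- The quantile transform of a uniform variable has law `P`. -/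
theorem map_quantile [IsProbabilityMeasure P] (R : IsRegularOn P I) :
    (volume.restrict (Ioo (0 : ℝ) 1)).map (quantile P) = P := by
  refine Measure.ext_of_Iic _ _ fun x => ?_
  rw [Measure.map_apply_of_aemeasurable R.aemeasurable_quantile measurableSet_Iic,
    Measure.restrict_apply' measurableSet_Ioo]
  have h0 := ProbabilityTheory.cdf_nonneg P x
  have h1 := ProbabilityTheory.cdf_le_one P x
  have : quantile P ⁻¹' Iic x ∩ Ioo 0 1 = Ioc 0 (ProbabilityTheory.cdf P x) \ {1} := by
    ext u
    simp only [mem_inter_iff, mem_preimage, mem_Iic, mem_sdiff, mem_Ioc, mem_singleton_iff]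
    constructor
    · rintro ⟨hq, hu⟩
      exact ⟨⟨hu.1, (R.quantile_le_iff hu x).1 hq⟩, hu.2.ne⟩
    · rintro ⟨⟨hu0, hux⟩, hu1⟩
      have hu : u ∈ Ioo (0 : ℝ) 1 := ⟨hu0, lt_of_le_of_ne (hux.trans h1) hu1⟩
      exact ⟨(R.quantile_le_iff hu x).2 hux, hu⟩
  rw [this, measure_sdiff_null (measure_singleton _), Real.volume_Ioc, sub_zero,
    ProbabilityTheory.ofReal_cdf]

theorem hasDerivAt_quantile_exp (R : IsRegularOn P I) {y : ℝ} (hy : y ∈ Ioi (0 : ℝ)) :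
    HasDerivAt (fun y => quantile P (Real.exp (-y))) (-hOfLaw P y) y := by
  have h1 : HasDerivAt (fun y : ℝ => Real.exp (-y)) (-Real.exp (-y)) y := by
    simpa using (hasDerivAt_neg y).exp
  have h2 := (R.hasDerivAt_quantile (exp_neg_mem hy)).comp y h1
  refine h2.congr_deriv ?_
  rw [hOfLaw]
  ring

theorem hOfLaw_pos (R : IsRegularOn P I) {y : ℝ} (hy : y ∈ Ioi (0 : ℝ)) : 0 < hOfLaw P y :=
  div_pos (Real.exp_pos _) (R.density_pos _ (R.quantile_mem (exp_neg_mem hy)).1)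

theorem continuousOn_hOfLaw (R : IsRegularOn P I) : ContinuousOn (hOfLaw P) (Ioi 0) := by
  have h1 : ContinuousOn (fun y => quantile P (Real.exp (-y))) (Ioi 0) := fun y hy =>
    (R.hasDerivAt_quantile_exp hy).continuousAt.continuousWithinAt
  refine ContinuousOn.div (by fun_prop) (R.continuousOn_density.comp h1 fun y hy =>
    (R.quantile_mem (exp_neg_mem hy)).1) fun y hy =>
    (R.density_pos _ (R.quantile_mem (exp_neg_mem hy)).1).ne'

/-- The substitution `t = F⁻¹(e^{-y})`. -/
theorem lintegral_comp_cdf (R : IsRegularOn P I) {φ : ℝ → ℝ} (h0 : φ 0 = 0) (h1 : φ 1 = 0) :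
    ∫⁻ t : ℝ, ENNReal.ofReal (φ (ProbabilityTheory.cdf P t))
      = ∫⁻ y in Ioi (0 : ℝ), ENNReal.ofReal (hOfLaw P y * φ (Real.exp (-y))) := by
  have himg : (fun y => quantile P (Real.exp (-y))) '' Ioi 0 = I := by
    refine Subset.antisymm ?_ fun x hx => ?_
    · rintro _ ⟨y, hy, rfl⟩
      exact (R.quantile_mem (exp_neg_mem hy)).1
    · have hu := R.cdf_mem hx
      refine ⟨-Real.log (ProbabilityTheory.cdf P x), neg_pos.2 (Real.log_neg hu.1 hu.2), ?_⟩
      simp only [neg_neg, Real.exp_log hu.1, R.quantile_cdf hx]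
  have hinj : InjOn (fun y => quantile P (Real.exp (-y))) (Ioi 0) := fun y hy z hz hyz => by
    have := R.strictMonoOn_quantile.injOn (exp_neg_mem hy) (exp_neg_mem hz) hyz
    exact neg_injective (Real.exp_injective this)
  have hrestr : ∫⁻ t : ℝ, ENNReal.ofReal (φ (ProbabilityTheory.cdf P t))
      = ∫⁻ t in I, ENNReal.ofReal (φ (ProbabilityTheory.cdf P t)) := by
    rw [← lintegral_indicator R.isOpen.measurableSet]
    refine lintegral_congr fun t => ?_
    by_cases ht : t ∈ I
    · rw [indicator_of_mem ht]
    · rw [indicator_of_notMem ht]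
      rcases R.cdf_notMem t ht with h | h <;> simp [h, h0, h1]
  rw [hrestr]
  conv_lhs => rw [← himg]
  rw [lintegral_image_eq_lintegral_abs_deriv_mul measurableSet_Ioi
    (fun y hy => (R.hasDerivAt_quantile_exp hy).hasDerivWithinAt) hinj]
  refine setLIntegral_congr_fun measurableSet_Ioi fun y hy => ?_
  rw [abs_neg, abs_of_pos (R.hOfLaw_pos hy), (R.quantile_mem (exp_neg_mem hy)).2,
    ENNReal.ofReal_mul (R.hOfLaw_pos hy).le]

end IsRegularOn

/-! ### The integral form of a law in the class -/

namespace IsRegularOn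

variable {P : Measure ℝ} {I : Set ℝ}

theorem aestronglyMeasurable_hOfLaw (R : IsRegularOn P I) :
    AEStronglyMeasurable (hOfLaw P) (volume.restrict (Ioi 0)) :=
  R.continuousOn_hOfLaw.aestronglyMeasurable measurableSet_Ioi

theorem integrableOn_hOfLaw [IsProbabilityMeasure P] (R : IsRegularOn P I)
    (hP : Integrable (fun x : ℝ => x) P) :
    IntegrableOn (fun y => hOfLaw P y * Real.exp (-y) * (1 - Real.exp (-y))) (Ioi 0) := by
  have h1 := (expectedMax_eq P hP (k := 2) (by norm_num)).1
  rw [R.lintegral_comp_cdf (φ := fun v => v - v ^ 2) (by norm_num) (by norm_num)] at h1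
  refine ⟨(R.aestronglyMeasurable_hOfLaw.mul (by fun_prop)).mul (by fun_prop), ?_⟩
  rw [hasFiniteIntegral_iff_ofReal]
  · convert h1.lt_top using 4
    ring
  · filter_upwards [ae_restrict_mem measurableSet_Ioi] with y hy
    obtain ⟨h2, h3⟩ := exp_neg_mem hy
    exact mul_nonneg (mul_nonneg (R.hOfLaw_pos hy).le h2.le) (by linarith)

theorem expectedMax_eq_integral [IsProbabilityMeasure P] (R : IsRegularOn P I)
    (hP : Integrable (fun x : ℝ => x) P) {k : ℕ} (hk : 1 ≤ k) :
    expectedMax P k = ∫ x, x ∂P +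
      ∫ y in Ioi (0 : ℝ), hOfLaw P y * (Real.exp (-y) - Real.exp (-(k * y))) := by
  have hk' : (1 : ℝ) ≤ k := by exact_mod_cast hk
  rw [(expectedMax_eq P hP hk).2, R.lintegral_comp_cdf (φ := fun v => v - v ^ k)
    (by simp [show k ≠ 0 by omega]) (by simp)]
  have e : ∀ y : ℝ, Real.exp (-y) ^ k = Real.exp (-(k * y)) := fun y => by
    rw [← Real.exp_nat_mul]
    congr 1
    ring
  simp only [e]
  congr 1
  rw [integral_eq_lintegral_of_nonneg_ae]
  · filter_upwards [ae_restrict_mem measurableSet_Ioi] with y hy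
    exact mul_nonneg (R.hOfLaw_pos hy).le (exp_sub_exp_le hk' hy).1
  · exact R.aestronglyMeasurable_hOfLaw.mul (by fun_prop)

end IsRegularOn

/-- The function `x ↦ E X + ∫₀^∞ h(y) (e^{-y} - e^{-xy}) dy`, with `h` the explicit function
attached to the law `P` of `X`: the extension of the expected maxima to real arguments. -/
noncomputable def maxExtension (P : Measure ℝ) (x : ℝ) : ℝ :=
  ∫ t, t ∂P + ∫ y in Ioi (0 : ℝ), hOfLaw P y * (Real.exp (-y) - Real.exp (-(x * y)))

theorem IsClassFLawOf.extends {μ : ℕ → ℝ} {P : Measure ℝ} (h : IsClassFLawOf μ P) :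
    Extends μ (maxExtension P) := by
  obtain ⟨hprob, hint, hF, hmax⟩ := h
  obtain ⟨I, R⟩ := hF.exists_isRegularOn
  intro k hk
  rw [hmax k hk, R.expectedMax_eq_integral hint hk, maxExtension]

theorem IsClassFLawOf.exists_isIntegralForm {μ : ℕ → ℝ} {P : Measure ℝ}
    (h : IsClassFLawOf μ P) : ∃ s, IsIntegralForm (maxExtension P) (hOfLaw P) s := by
  obtain ⟨hprob, hint, hF, -⟩ := h
  obtain ⟨I, R⟩ := hF.exists_isRegularOn
  exact ⟨_, isIntegralForm_of_continuousOn (fun y hy => R.hOfLaw_pos hy) R.continuousOn_hOfLaw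
    (R.integrableOn_hOfLaw hint) _⟩

theorem MemClassF.hOfLaw_pos {P : Measure ℝ} [IsProbabilityMeasure P] (h : MemClassF P) :
    ∀ y ∈ Ioi (0 : ℝ), 0 < hOfLaw P y := by
  obtain ⟨I, R⟩ := h.exists_isRegularOn
  exact fun y hy => R.hOfLaw_pos hy

theorem MemClassF.continuousOn_hOfLaw {P : Measure ℝ} [IsProbabilityMeasure P]
    (h : MemClassF P) : ContinuousOn (hOfLaw P) (Ioi 0) := by
  obtain ⟨I, R⟩ := h.exists_isRegularOn
  exact R.continuousOn_hOfLaw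

theorem IsClassFLawOf.isRegularExtension {μ : ℕ → ℝ} {P : Measure ℝ} (h : IsClassFLawOf μ P) :
    IsRegularExtension μ (maxExtension P) := by
  have := h.1
  obtain ⟨s, hs⟩ := h.exists_isIntegralForm
  exact ⟨h.extends, _, s, hs, h.2.2.1.hOfLaw_pos, h.2.2.1.continuousOn_hOfLaw⟩

/-- The expected maxima determine `h`, hence the quantile function up to an additive constant,
and the mean determines the constant. -/
theorem IsClassFLawOf.unique {μ : ℕ → ℝ} {P P' : Measure ℝ} (h : IsClassFLawOf μ P)
    (h' : IsClassFLawOf μ P') : P' = P := by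
  have := h.1
  have := h'.1
  obtain ⟨s, hs⟩ := h.exists_isIntegralForm
  obtain ⟨s', hs'⟩ := h'.exists_isIntegralForm
  have hh : EqOn (hOfLaw P) (hOfLaw P') (Ioi 0) :=
    Measure.eqOn_open_of_ae_eq (hs.ae_eq hs' h.extends h'.extends) isOpen_Ioi
      h.2.2.1.continuousOn_hOfLaw h'.2.2.1.continuousOn_hOfLaw
  obtain ⟨I, R⟩ := h.2.2.1.exists_isRegularOn
  obtain ⟨I', R'⟩ := h'.2.2.1.exists_isRegularOn
  obtain ⟨d, hd⟩ := isOpen_Ioi.exists_eq_add_of_deriv_eq isPreconnected_Ioi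
    (fun y hy => (R'.hasDerivAt_quantile_exp hy).differentiableAt.differentiableWithinAt)
    (fun y hy => (R.hasDerivAt_quantile_exp hy).differentiableAt.differentiableWithinAt)
    (fun y hy => by
      rw [(R.hasDerivAt_quantile_exp hy).deriv, (R'.hasDerivAt_quantile_exp hy).deriv, hh hy])
  have hq : ∀ u ∈ Ioo (0 : ℝ) 1, quantile P' u = quantile P u + d := fun u hu => by
    have := hd (show -Real.log u ∈ Ioi (0 : ℝ) from neg_pos.2 (Real.log_neg hu.1 hu.2))
    simpa only [neg_neg, Real.exp_log hu.1] using this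
  have hmean : ∀ Q : Measure ℝ, IsClassFLawOf μ Q → ∫ x, x ∂Q = μ 1 := fun Q hQ => by
    have := hQ.1
    obtain ⟨J, S⟩ := hQ.2.2.1.exists_isRegularOn
    rw [hQ.2.2.2 1 le_rfl, S.expectedMax_eq_integral hQ.2.1 le_rfl]
    simp
  have hint : ∀ {Q : Measure ℝ} {J : Set ℝ}, IsProbabilityMeasure Q → IsRegularOn Q J →
      ∫ x, x ∂Q = ∫ u in Ioo (0 : ℝ) 1, quantile Q u := fun {Q J} hQ S => by
    conv_lhs => rw [← S.map_quantile]
    exact integral_map S.aemeasurable_quantile (by fun_prop)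
  have hi : IntegrableOn (quantile P) (Ioo 0 1) := by
    have h1 := h.2.1
    rw [← R.map_quantile] at h1
    exact (integrable_map_measure (by fun_prop) R.aemeasurable_quantile).1 h1
  have hd0 : d = 0 := by
    have e := (hint h'.1 R').symm.trans ((hmean P' h').trans ((hmean P h).symm.trans (hint h.1 R)))
    rw [setIntegral_congr_fun measurableSet_Ioo hq, integral_add hi (integrable_const d)] at e
    simpa using e
  rw [← R'.map_quantile, ← R.map_quantile]
  refine Measure.map_congr ?_
  filter_upwards [ae_restrict_mem measurableSet_Ioo] with u hu
  rw [hq u hu, hd0, add_zero]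

/-! ### The law with a prescribed quantile function -/

/-- An open order-connected set of reals is an open interval with extended real endpoints. -/
theorem exists_eq_realIoo {J : Set ℝ} (ho : IsOpen J) (hJ : J.OrdConnected) (hne : J.Nonempty) :
    ∃ α ω : EReal, α < ω ∧ J = realIoo α ω := by
  have hlt : ∀ x ∈ J, sInf ((↑) '' J) < (x : EReal) ∧ (x : EReal) < sSup ((↑) '' J) := by
    intro x hx
    obtain ⟨l, u, hlu, hsub⟩ := mem_nhds_iff_exists_Ioo_subset.1 (ho.mem_nhds hx)
    obtain ⟨a, ha1, ha2⟩ := exists_between hlu.1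
    obtain ⟨b, hb1, hb2⟩ := exists_between hlu.2
    refine ⟨(sInf_le (mem_image_of_mem _ (hsub ⟨ha1, ha2.trans hlu.2⟩))).trans_lt
      (EReal.coe_lt_coe_iff.2 ha2), (EReal.coe_lt_coe_iff.2 hb1).trans_le
      (le_sSup (mem_image_of_mem _ (hsub ⟨hlu.1.trans hb1, hb2⟩)))⟩
  obtain ⟨x₀, hx₀⟩ := hne
  refine ⟨_, _, (hlt x₀ hx₀).1.trans (hlt x₀ hx₀).2, Subset.antisymm hlt ?_⟩
  rintro x ⟨h1, h2⟩
  obtain ⟨_, ⟨a, ha, rfl⟩, hax⟩ := sInf_lt_iff.1 h1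
  obtain ⟨_, ⟨b, hb, rfl⟩, hxb⟩ := lt_sSup_iff.1 h2
  exact hJ.out ha hb ⟨(EReal.coe_lt_coe_iff.1 hax).le, (EReal.coe_lt_coe_iff.1 hxb).le⟩

section PrescribedQuantile

variable {q q' : ℝ → ℝ}

theorem strictMonoOn_of_hasDerivAt_pos (hq : ∀ u ∈ Ioo (0 : ℝ) 1, HasDerivAt q (q' u) u)
    (hpos : ∀ u ∈ Ioo (0 : ℝ) 1, 0 < q' u) : StrictMonoOn q (Ioo 0 1) := by
  refine strictMonoOn_of_deriv_pos (convex_Ioo 0 1)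
    (fun u hu => (hq u hu).continuousAt.continuousWithinAt) fun u hu => ?_
  rw [interior_Ioo] at hu
  rw [(hq u hu).deriv]
  exact hpos u hu

theorem isOpen_image_Ioo (hm : StrictMonoOn q (Ioo 0 1)) (hc : ContinuousOn q (Ioo 0 1)) :
    IsOpen (q '' Ioo 0 1) := by
  refine isOpen_iff_mem_nhds.2 ?_
  rintro _ ⟨u, hu, rfl⟩
  obtain ⟨a, ha1, ha2⟩ := exists_between hu.1
  obtain ⟨b, hb1, hb2⟩ := exists_between hu.2
  have ha : a ∈ Ioo (0 : ℝ) 1 := ⟨ha1, ha2.trans hu.2⟩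
  have hb : b ∈ Ioo (0 : ℝ) 1 := ⟨hu.1.trans hb1, hb2⟩
  have hsub : Icc a b ⊆ Ioo 0 1 := fun t ht => ⟨ha1.trans_le ht.1, ht.2.trans_lt hb2⟩
  exact Filter.mem_of_superset (Ioo_mem_nhds (hm ha hu ha2) (hm hu hb hb1))
    ((intermediate_value_Ioo (ha2.trans hb1).le (hc.mono hsub)).trans
      (image_mono (Ioo_subset_Icc_self.trans hsub)))

/-- The image of the uniform law on `(0, 1)` under `q`. -/
noncomputable def lawOfQuantile (q : ℝ → ℝ) : Measure ℝ :=
  (volume.restrict (Ioo (0 : ℝ) 1)).map q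

theorem isProbabilityMeasure_lawOfQuantile (hm : StrictMonoOn q (Ioo 0 1)) :
    IsProbabilityMeasure (lawOfQuantile q) := by
  have : IsProbabilityMeasure (volume.restrict (Ioo (0 : ℝ) 1)) := ⟨by simp⟩
  exact Measure.isProbabilityMeasure_map
    (aemeasurable_restrict_of_monotoneOn measurableSet_Ioo hm.monotoneOn)

theorem cdf_lawOfQuantile (hm : StrictMonoOn q (Ioo 0 1)) {u : ℝ} (hu : u ∈ Ioo (0 : ℝ) 1) :
    ProbabilityTheory.cdf (lawOfQuantile q) (q u) = u := by
  have := isProbabilityMeasure_lawOfQuantile hm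
  have hset : q ⁻¹' Iic (q u) ∩ Ioo 0 1 = Ioc 0 u := by
    ext v
    simp only [mem_inter_iff, mem_preimage, mem_Iic, mem_Ioc]
    refine ⟨fun h => ⟨h.2.1, (hm.le_iff_le h.2 hu).1 h.1⟩, fun h => ?_⟩
    have hv : v ∈ Ioo (0 : ℝ) 1 := ⟨h.1, h.2.trans_lt hu.2⟩
    exact ⟨(hm.le_iff_le hv hu).2 h.2, hv⟩
  rw [ProbabilityTheory.cdf_eq_real, measureReal_def, lawOfQuantile,
    Measure.map_apply_of_aemeasurable
      (aemeasurable_restrict_of_monotoneOn measurableSet_Ioo hm.monotoneOn) measurableSet_Iic,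
    Measure.restrict_apply' measurableSet_Ioo, hset, Real.volume_Ioc, sub_zero,
    ENNReal.toReal_ofReal hu.1.le]

theorem hasDerivAt_cdf_lawOfQuantile (hq : ∀ u ∈ Ioo (0 : ℝ) 1, HasDerivAt q (q' u) u)
    (hpos : ∀ u ∈ Ioo (0 : ℝ) 1, 0 < q' u) {u : ℝ} (hu : u ∈ Ioo (0 : ℝ) 1) :
    HasDerivAt (fun t => ProbabilityTheory.cdf (lawOfQuantile q) t) (q' u)⁻¹ (q u) := by
  have hm := strictMonoOn_of_hasDerivAt_pos hq hpos
  exact hasDerivAt_leftInverse isOpen_Ioo hm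
    (isOpen_image_Ioo hm fun u hu => (hq u hu).continuousAt.continuousWithinAt)
    (fun v hv => cdf_lawOfQuantile hm hv) hu (hq u hu) (hpos u hu).ne'

theorem density_lawOfQuantile (hq : ∀ u ∈ Ioo (0 : ℝ) 1, HasDerivAt q (q' u) u)
    (hpos : ∀ u ∈ Ioo (0 : ℝ) 1, 0 < q' u) {u : ℝ} (hu : u ∈ Ioo (0 : ℝ) 1) :
    density (lawOfQuantile q) (q u) = (q' u)⁻¹ :=
  (hasDerivAt_cdf_lawOfQuantile hq hpos hu).deriv

theorem memClassF_lawOfQuantile (hq : ∀ u ∈ Ioo (0 : ℝ) 1, HasDerivAt q (q' u) u)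
    (hpos : ∀ u ∈ Ioo (0 : ℝ) 1, 0 < q' u) (hc : ContinuousOn q' (Ioo 0 1)) :
    MemClassF (lawOfQuantile q) := by
  have hm := strictMonoOn_of_hasDerivAt_pos hq hpos
  have hqc : ContinuousOn q (Ioo 0 1) := fun u hu => (hq u hu).continuousAt.continuousWithinAt
  have hqm : AEMeasurable q (volume.restrict (Ioo 0 1)) :=
    aemeasurable_restrict_of_monotoneOn measurableSet_Ioo hm.monotoneOn
  have hJ := isOpen_image_Ioo hm hqc
  obtain ⟨α, ω, hαω, hJeq⟩ := exists_eq_realIoo hJ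
    (isPreconnected_Ioo.image q hqc).ordConnected ((nonempty_Ioo.2 one_pos).image q)
  refine ⟨Measure.AbsolutelyContinuous.mk fun N hN hN0 => ?_, α, ω, hαω, ?_, ?_, ?_, ?_⟩
  · -- The differentiable inverse `F` of `q` maps null sets to null sets.
    rw [lawOfQuantile, Measure.map_apply_of_aemeasurable hqm hN,
      Measure.restrict_apply' measurableSet_Ioo]
    have himg := addHaar_image_eq_zero_of_differentiableOn_of_addHaar_eq_zero volume
      (s := N ∩ q '' Ioo 0 1) (f := fun t => ProbabilityTheory.cdf (lawOfQuantile q) t) (by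
        rintro _ ⟨-, u, hu, rfl⟩
        exact (hasDerivAt_cdf_lawOfQuantile hq hpos hu).differentiableAt.differentiableWithinAt)
      (measure_mono_null inter_subset_left hN0)
    refine measure_mono_null (fun u hu => ?_) himg
    exact ⟨q u, ⟨hu.1, mem_image_of_mem q hu.2⟩, cdf_lawOfQuantile hm hu.2⟩
  · rw [← hJeq, lawOfQuantile, Measure.map_apply_of_aemeasurable hqm hJ.measurableSet.compl,
      Measure.restrict_apply' measurableSet_Ioo]
    have : q ⁻¹' (q '' Ioo 0 1)ᶜ ∩ Ioo 0 1 = ∅ :=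
      eq_empty_of_forall_notMem fun u hu => hu.1 (mem_image_of_mem q hu.2)
    rw [this, measure_empty]
  · rw [← hJeq]
    rintro _ ⟨u, hu, rfl⟩
    exact (hasDerivAt_cdf_lawOfQuantile hq hpos hu).differentiableAt
  · rw [← hJeq]
    rintro _ ⟨u, hu, rfl⟩
    rw [density_lawOfQuantile hq hpos hu]
    exact inv_pos.2 (hpos u hu)
  · rw [← hJeq]
    have hF : ContinuousOn (fun t => ProbabilityTheory.cdf (lawOfQuantile q) t)
        (q '' Ioo 0 1) := by
      rintro _ ⟨u, hu, rfl⟩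
      exact (hasDerivAt_cdf_lawOfQuantile hq hpos hu).continuousAt.continuousWithinAt
    have hFm : MapsTo (fun t => ProbabilityTheory.cdf (lawOfQuantile q) t) (q '' Ioo 0 1)
        (Ioo 0 1) := by
      rintro _ ⟨u, hu, rfl⟩
      simpa only [cdf_lawOfQuantile hm hu] using hu
    refine ContinuousOn.congr ((hc.comp hF hFm).inv₀ fun x hx => (hpos _ (hFm hx)).ne') ?_
    rintro _ ⟨u, hu, rfl⟩
    simp only [density_lawOfQuantile hq hpos hu, Function.comp_apply, cdf_lawOfQuantile hm hu,
      Pi.inv_apply]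

theorem quantile_lawOfQuantile (hq : ∀ u ∈ Ioo (0 : ℝ) 1, HasDerivAt q (q' u) u)
    (hpos : ∀ u ∈ Ioo (0 : ℝ) 1, 0 < q' u) (hc : ContinuousOn q' (Ioo 0 1)) {u : ℝ}
    (hu : u ∈ Ioo (0 : ℝ) 1) : quantile (lawOfQuantile q) u = q u := by
  have hm := strictMonoOn_of_hasDerivAt_pos hq hpos
  have := isProbabilityMeasure_lawOfQuantile hm
  obtain ⟨I, R⟩ := (memClassF_lawOfQuantile hq hpos hc).exists_isRegularOn
  have hF := cdf_lawOfQuantile hm hu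
  have hI : q u ∈ I := by
    by_contra h
    rcases R.cdf_notMem _ h with h | h
    · exact hu.1.ne (h.symm.trans hF)
    · exact hu.2.ne (hF.symm.trans h)
  simpa only [hF] using R.quantile_cdf hI

end PrescribedQuantile

/-! ### The law with a prescribed integral form -/

section PrescribedForm

variable {h : ℝ → ℝ}

/-- The quantile function `u ↦ c - ∫_1^{-log u} h`, which solves `d/dy F⁻¹(e^{-y}) = -h(y)`. -/
noncomputable def quantileOfForm (h : ℝ → ℝ) (c u : ℝ) : ℝ :=
  c - ∫ t in (1 : ℝ)..(-Real.log u), h t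

theorem hasDerivAt_quantileOfForm (hc : ContinuousOn h (Ioi 0)) (c : ℝ) {u : ℝ}
    (hu : u ∈ Ioo (0 : ℝ) 1) :
    HasDerivAt (quantileOfForm h c) (h (-Real.log u) / u) u := by
  have hy : -Real.log u ∈ Ioi (0 : ℝ) := neg_pos.2 (Real.log_neg hu.1 hu.2)
  have hsub : uIcc 1 (-Real.log u) ⊆ Ioi 0 :=
    ordConnected_Ioi.uIcc_subset (mem_Ioi.2 one_pos) hy
  have h1 := intervalIntegral.integral_hasDerivAt_right
    (hc.mono hsub).intervalIntegrable
    (hc.stronglyMeasurableAtFilter isOpen_Ioi _ hy) (hc.continuousAt (isOpen_Ioi.mem_nhds hy))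
  have h2 := (h1.comp u (Real.hasDerivAt_log hu.1.ne').neg).const_sub c
  refine h2.congr_deriv ?_
  rw [div_eq_mul_inv]
  ring

theorem quantileOfForm_deriv_pos (hpos : ∀ y ∈ Ioi (0 : ℝ), 0 < h y) :
    ∀ u ∈ Ioo (0 : ℝ) 1, 0 < h (-Real.log u) / u := fun _ hu =>
  div_pos (hpos _ (neg_pos.2 (Real.log_neg hu.1 hu.2))) hu.1

theorem continuousOn_quantileOfForm_deriv (hc : ContinuousOn h (Ioi 0)) :
    ContinuousOn (fun u => h (-Real.log u) / u) (Ioo 0 1) := by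
  refine ContinuousOn.div (hc.comp ?_ fun u hu => neg_pos.2 (Real.log_neg hu.1 hu.2))
    continuousOn_id fun u hu => hu.1.ne'
  exact (Real.continuousOn_log.mono fun u hu => hu.1.ne').neg

theorem hOfLaw_quantileOfForm (hpos : ∀ y ∈ Ioi (0 : ℝ), 0 < h y) (hc : ContinuousOn h (Ioi 0))
    (c : ℝ) : EqOn (hOfLaw (lawOfQuantile (quantileOfForm h c))) h (Ioi 0) := by
  intro y hy
  have hq := fun u hu => hasDerivAt_quantileOfForm hc c (u := u) hu
  have hu := exp_neg_mem hy
  rw [hOfLaw, quantile_lawOfQuantile hq (quantileOfForm_deriv_pos hpos)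
    (continuousOn_quantileOfForm_deriv hc) hu,
    density_lawOfQuantile hq (quantileOfForm_deriv_pos hpos) hu, Real.log_exp, neg_neg, inv_div,
    div_div_cancel₀ hu.1.ne']

/-- Every strictly positive continuous `h` subject to the finiteness condition is the explicit
function of an integrable law in the class, with arbitrary mean. -/
theorem exists_law_of_form (hpos : ∀ y ∈ Ioi (0 : ℝ), 0 < h y) (hc : ContinuousOn h (Ioi 0))
    (hf : IntegrableOn (fun y => h y * Real.exp (-y) * (1 - Real.exp (-y))) (Ioi 0)) (m : ℝ) :
    ∃ P : Measure ℝ, IsProbabilityMeasure P ∧ Integrable (fun x : ℝ => x) P ∧ MemClassF P ∧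
      ∫ x, x ∂P = m ∧ EqOn (hOfLaw P) h (Ioi 0) := by
  have hq := fun c u hu => hasDerivAt_quantileOfForm hc c (u := u) hu
  have hp := quantileOfForm_deriv_pos hpos
  have hm := fun c => strictMonoOn_of_hasDerivAt_pos (hq c) hp
  have hprob := fun c => isProbabilityMeasure_lawOfQuantile (hm c)
  have hmem := fun c => memClassF_lawOfQuantile (hq c) hp (continuousOn_quantileOfForm_deriv hc)
  have hae : ∀ c, AEMeasurable (quantileOfForm h c) (volume.restrict (Ioo 0 1)) := fun c =>
    aemeasurable_restrict_of_monotoneOn measurableSet_Ioo (hm c).monotoneOn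
  have hi0 : IntegrableOn (quantileOfForm h 0) (Ioo 0 1) := by
    have := hprob 0
    obtain ⟨I, R⟩ := (hmem 0).exists_isRegularOn
    have hhalf : (1 / 2 : ℝ) ∈ Ioo (0 : ℝ) 1 := ⟨by norm_num, by norm_num⟩
    have hF := cdf_lawOfQuantile (hm 0) hhalf
    have hint := integrable_of_lintegral_cdf (lawOfQuantile (quantileOfForm h 0))
      (a := quantileOfForm h 0 (1 / 2)) (by rw [hF]; norm_num) (by rw [hF]; norm_num) (by
        rw [R.lintegral_comp_cdf (φ := fun v => v - v ^ 2) (by norm_num) (by norm_num),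
          setLIntegral_congr_fun (g := fun y => ENNReal.ofReal
            (h y * Real.exp (-y) * (1 - Real.exp (-y)))) measurableSet_Ioi fun y hy => by
              simp only
              rw [hOfLaw_quantileOfForm hpos hc 0 hy]
              congr 1
              ring]
        exact hf.lintegral_lt_top.ne)
    exact (integrable_map_measure (by fun_prop) (hae 0)).1 hint
  set c := m - ∫ u in Ioo (0 : ℝ) 1, quantileOfForm h 0 u with hcdef
  have hqc : quantileOfForm h c = fun u => quantileOfForm h 0 u + c := by
    funext u
    simp only [quantileOfForm]
    ring
  have hic : IntegrableOn (quantileOfForm h c) (Ioo 0 1) := by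
    rw [hqc]
    exact hi0.add (integrable_const c)
  refine ⟨lawOfQuantile (quantileOfForm h c), hprob c,
    (integrable_map_measure (by fun_prop) (hae c)).2 hic, hmem c, ?_,
    hOfLaw_quantileOfForm hpos hc c⟩
  rw [lawOfQuantile, integral_map (hae c) (by fun_prop), hqc, integral_add hi0 (integrable_const c)]
  simp [hcdef]

end PrescribedForm

theorem IsRegularExtension.exists_law {μ : ℕ → ℝ} {g : ℝ → ℝ} (H : IsRegularExtension μ g) :
    ∃ P : Measure ℝ, IsClassFLawOf μ P := by
  obtain ⟨hg, h, s, hs, hpos, hc⟩ := H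
  obtain ⟨P, hprob, hint, hF, hmean, hh⟩ := exists_law_of_form hpos hc hs.finite (g 1)
  refine ⟨P, hprob, hint, hF, fun k hk => ?_⟩
  obtain ⟨I, R⟩ := hF.exists_isRegularOn
  rw [hg k hk, hs.eq_add (by exact_mod_cast hk : (1 : ℝ) ≤ k), R.expectedMax_eq_integral hint hk,
    hmean]
  congr 1
  refine setIntegral_congr_fun measurableSet_Ioi fun y hy => ?_
  simp only [hh hy]

end ExpectedMaxima

theorem theorem3p2 (μ : ℕ → ℝ) :
    ((∃ P : Measure ℝ, ExpectedMaxima.IsClassFLawOf μ P) ↔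
      ∃ g : ℝ → ℝ, ExpectedMaxima.IsRegularExtension μ g) ∧
    (((∃ P : Measure ℝ, ExpectedMaxima.IsClassFLawOf μ P) ∨
        ∃ g : ℝ → ℝ, ExpectedMaxima.IsRegularExtension μ g) →
      ∃ (P : Measure ℝ) (g : ℝ → ℝ),
        -- the law in the class is unique
        ExpectedMaxima.IsClassFLawOf μ P ∧
        (∀ P' : Measure ℝ, ExpectedMaxima.IsClassFLawOf μ P' → P' = P) ∧
        -- `g` is unique, even among all extensions that have an integral form
        ExpectedMaxima.IsRegularExtension μ g ∧
        (∀ g' h' s' : ℝ → ℝ, ExpectedMaxima.Extends μ g' →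
          ExpectedMaxima.IsIntegralForm g' h' s' → EqOn g' g (Ici 1)) ∧
        -- the explicit function is strictly positive, continuous, and represents `g`
        (∀ y ∈ Ioi (0 : ℝ), 0 < ExpectedMaxima.hOfLaw P y) ∧
        ContinuousOn (ExpectedMaxima.hOfLaw P) (Ioi 0) ∧
        (∃ s : ℝ → ℝ, ExpectedMaxima.IsIntegralForm g (ExpectedMaxima.hOfLaw P) s) ∧
        -- it is the only continuous version, and every version agrees with it almost everywhere
        (∀ h s : ℝ → ℝ, ExpectedMaxima.IsIntegralForm g h s →
          (ContinuousOn h (Ioi 0) → EqOn h (ExpectedMaxima.hOfLaw P) (Ioi 0)) ∧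
          h =ᵐ[volume.restrict (Ioi 0)] ExpectedMaxima.hOfLaw P)) := by
  have hiff : (∃ P : Measure ℝ, ExpectedMaxima.IsClassFLawOf μ P) ↔
      ∃ g : ℝ → ℝ, ExpectedMaxima.IsRegularExtension μ g :=
    ⟨fun ⟨_, hP⟩ => ⟨_, hP.isRegularExtension⟩, fun ⟨_, hg⟩ => hg.exists_law⟩
  refine ⟨hiff, fun h => ?_⟩
  obtain ⟨P, hP⟩ := h.elim id hiff.2
  have := hP.1
  obtain ⟨s, hs⟩ := hP.exists_isIntegralForm
  refine ⟨P, ExpectedMaxima.maxExtension P, hP, fun P' hP' => hP.unique hP',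
    hP.isRegularExtension, fun g' h' s' hg' hs' => hs'.eqOn hs hg' hP.extends,
    hP.2.2.1.hOfLaw_pos, hP.2.2.1.continuousOn_hOfLaw, ⟨s, hs⟩, fun h₂ s₂ hs₂ => ?_⟩
  have hae := hs₂.ae_eq hs hP.extends hP.extends
  exact ⟨fun hc => Measure.eqOn_open_of_ae_eq hae isOpen_Ioi hc hP.2.2.1.continuousOn_hOfLaw, hae⟩
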